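/- Let $\Lambda$ and $\Gamma$ be arbitrary (unital, associative) rings, let $M$ be a $(\Lambda,\Gamma)$-bimodule, and let $$T=\begin{pmatrix}\Lambda & M\\ 0 & \Gamma\end{pmatrix}$$ be the upper triangular matrix ring. A left module $G$ over a ring $R$ is called Gorenstein projective if there is an exact complex $\cdots\to Q_1\to Q_0\to Q^0\to Q^1\to\cdots$ of projective left $R$-modules which remains exact after applying $\operatorname{Hom}_R(-,P)$ for every projective left $R$-module $P$, and such that $G\cong\operatorname{Im}(Q_0\to Q^0)$. A ring $R$ is called strongly left CM-free if every Gorenstein projective left $R$-module (not necessarily finitely generated) is projective. Assume that the right $\Gamma$-module $M_\Gamma$ has finite flat dimension and that the left $\Lambda$-module ${}_\Lambda M$ has finite projective dimension. Then $T$ is strongly left CM-free if and only if both $\Lambda$ and $\Gamma$ are strongly left CM-free. -/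

import Mathlib

open CategoryTheory

open scoped TensorProduct

universe v u

namespace TriCM

section Gorenstein

variable {C : Type u} [Category.{v} C] [Abelian C]

/-- A complete projective resolution in an abelian category: an exact complex
`⋯ → K⁻¹ → K⁰ → K¹ → ⋯` of projective objects such that the complex `Hom(K, P)` is exact
for every projective object `P`, i.e. every `f : K^{i+1} ⟶ P` that vanishes on the incoming
differential factors through the outgoing one. -/
structure IsCompleteProjectiveResolution (K : CochainComplex C ℤ) : Prop where
  projective (i : ℤ) : Projective (K.X i)
  acyclic : K.Acyclic
  hom_exact (P : C) (_ : Projective P) (i : ℤ) (f : K.X (i + 1) ⟶ P)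
    (_ : K.d i (i + 1) ≫ f = 0) :
    ∃ g : K.X (i + 1 + 1) ⟶ P, K.d (i + 1) (i + 1 + 1) ≫ g = f

/-- An object is Gorenstein projective if it is isomorphic to the image of the differential
`K⁻¹ ⟶ K⁰` of some complete projective resolution `K`. -/
def IsGorensteinProjective (G : C) : Prop :=
  ∃ K : CochainComplex C ℤ, IsCompleteProjectiveResolution K ∧
    Nonempty (G ≅ Limits.image (K.d (-1) 0))

end Gorenstein

/-- A ring `R` is strongly left CM-free if every Gorenstein projective left `R`-module
(not necessarily finitely generated) is projective. -/
def StronglyLeftCMFree (R : Type u) [Ring R] : Prop :=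
  ∀ G : ModuleCat.{u} R, IsGorensteinProjective G → Projective G

section Flat

variable (Γ : Type u) [Ring Γ]

/-- The subgroup of `M ⊗[ℤ] N` generated by the elements `(m γ) ⊗ n - m ⊗ (γ n)`, for a right
`Γ`-module `M` and a left `Γ`-module `N`. -/
def balancedRelations (M : Type u) [AddCommGroup M] [Module Γᵐᵒᵖ M]
    (N : Type u) [AddCommGroup N] [Module Γ N] : AddSubgroup (M ⊗[ℤ] N) :=
  AddSubgroup.closure
    {x | ∃ (m : M) (γ : Γ) (n : N), x = (MulOpposite.op γ • m) ⊗ₜ[ℤ] n - m ⊗ₜ[ℤ] (γ • n)}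

/-- The tensor product `M ⊗_Γ N` of a right module and a left module over a ring that need not
be commutative. -/
abbrev BalancedTensor (M : Type u) [AddCommGroup M] [Module Γᵐᵒᵖ M]
    (N : Type u) [AddCommGroup N] [Module Γ N] : Type u :=
  (M ⊗[ℤ] N) ⧸ balancedRelations Γ M N

/-- The additive map `M ⊗_Γ f : M ⊗_Γ N → M ⊗_Γ N'`, `m ⊗ n ↦ m ⊗ f n`. -/
def balancedTensorMap (M : Type u) [AddCommGroup M] [Module Γᵐᵒᵖ M]
    {N N' : Type u} [AddCommGroup N] [Module Γ N] [AddCommGroup N'] [Module Γ N']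
    (f : N →ₗ[Γ] N') : BalancedTensor Γ M N →+ BalancedTensor Γ M N' :=
  QuotientAddGroup.map (balancedRelations Γ M N) (balancedRelations Γ M N')
    (TensorProduct.map (LinearMap.id : M →ₗ[ℤ] M)
      f.toAddMonoidHom.toIntLinearMap).toAddMonoidHom (by
      refine (AddSubgroup.closure_le _).2 ?_
      rintro _ ⟨m, γ, n, rfl⟩
      refine AddSubgroup.subset_closure ⟨m, γ, f n, ?_⟩
      change TensorProduct.map _ _ (_ ⊗ₜ[ℤ] n - m ⊗ₜ[ℤ] (γ • n)) = _
      rw [map_sub, TensorProduct.map_tmul, TensorProduct.map_tmul]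
      change _ - m ⊗ₜ[ℤ] f (γ • n) = _
      rw [f.map_smul]
      rfl)

/-- A right `Γ`-module `M` is flat if `M ⊗_Γ -` preserves injectivity of maps of left
`Γ`-modules. -/
def IsFlatRight (M : Type u) [AddCommGroup M] [Module Γᵐᵒᵖ M] : Prop :=
  ∀ (N N' : Type u) [AddCommGroup N] [Module Γ N] [AddCommGroup N'] [Module Γ N']
    (f : N →ₗ[Γ] N'), Function.Injective f → Function.Injective (balancedTensorMap Γ M f)

/-- A right `Γ`-module `M` has finite flat dimension if for some `n` there is an exact sequence
`0 → Fₙ → ⋯ → F₁ → F₀ → M → 0` of right `Γ`-modules with all `Fᵢ` flat. -/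
def HasFiniteFlatDimensionRight (M : Type u) [AddCommGroup M] [Module Γᵐᵒᵖ M] : Prop :=
  ∃ (n : ℕ) (F : ℕ → ModuleCat.{u} Γᵐᵒᵖ) (d : ∀ i, F (i + 1) →ₗ[Γᵐᵒᵖ] F i)
    (ε : F 0 →ₗ[Γᵐᵒᵖ] M),
    (∀ i, IsFlatRight Γ (F i)) ∧ (∀ i, n < i → Subsingleton (F i)) ∧
    Function.Surjective ε ∧ Function.Exact (d 0) ε ∧ ∀ i, Function.Exact (d (i + 1)) (d i)

end Flat

/-- A left module has finite projective dimension. -/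
def HasFiniteProjectiveDimension (R : Type u) [Ring R] (M : Type u) [AddCommGroup M]
    [Module R M] : Prop :=
  ∃ n : ℕ, HasProjectiveDimensionLE (ModuleCat.of R M) n

/-- The upper triangular matrices `(a m; 0 b)` with `a ∈ Λ`, `m ∈ M`, `b ∈ Γ`. -/
@[ext]
structure UpperTriangular (Λ M Γ : Type u) : Type u where
  a : Λ
  m : M
  b : Γ

namespace UpperTriangular

variable {Λ M Γ : Type u} [Ring Λ] [Ring Γ] [AddCommGroup M]

instance : Zero (UpperTriangular Λ M Γ) := ⟨⟨0, 0, 0⟩⟩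
instance : One (UpperTriangular Λ M Γ) := ⟨⟨1, 0, 1⟩⟩
instance : Add (UpperTriangular Λ M Γ) := ⟨fun x y => ⟨x.a + y.a, x.m + y.m, x.b + y.b⟩⟩
instance : Neg (UpperTriangular Λ M Γ) := ⟨fun x => ⟨-x.a, -x.m, -x.b⟩⟩

@[simp] theorem zero_a : (0 : UpperTriangular Λ M Γ).a = 0 := rfl
@[simp] theorem zero_m : (0 : UpperTriangular Λ M Γ).m = 0 := rfl
@[simp] theorem zero_b : (0 : UpperTriangular Λ M Γ).b = 0 := rfl
@[simp] theorem one_a : (1 : UpperTriangular Λ M Γ).a = 1 := rfl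
@[simp] theorem one_m : (1 : UpperTriangular Λ M Γ).m = 0 := rfl
@[simp] theorem one_b : (1 : UpperTriangular Λ M Γ).b = 1 := rfl
@[simp] theorem add_a (x y : UpperTriangular Λ M Γ) : (x + y).a = x.a + y.a := rfl
@[simp] theorem add_m (x y : UpperTriangular Λ M Γ) : (x + y).m = x.m + y.m := rfl
@[simp] theorem add_b (x y : UpperTriangular Λ M Γ) : (x + y).b = x.b + y.b := rfl
@[simp] theorem neg_a (x : UpperTriangular Λ M Γ) : (-x).a = -x.a := rfl
@[simp] theorem neg_m (x : UpperTriangular Λ M Γ) : (-x).m = -x.m := rfl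
@[simp] theorem neg_b (x : UpperTriangular Λ M Γ) : (-x).b = -x.b := rfl

instance : AddCommGroup (UpperTriangular Λ M Γ) where
  add_assoc x y z := by ext <;> simp [add_assoc]
  zero_add x := by ext <;> simp
  add_zero x := by ext <;> simp
  add_comm x y := by ext <;> simp [add_comm]
  neg_add_cancel x := by ext <;> simp
  nsmul := nsmulRec
  zsmul := zsmulRec

variable [Module Λ M] [Module Γᵐᵒᵖ M]

/-- Matrix multiplication: the upper right entry of the product is `a m' + m b'`. -/
instance : Mul (UpperTriangular Λ M Γ) :=
  ⟨fun x y => ⟨x.a * y.a, x.a • y.m + MulOpposite.op y.b • x.m, x.b * y.b⟩⟩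

@[simp] theorem mul_a (x y : UpperTriangular Λ M Γ) : (x * y).a = x.a * y.a := rfl
@[simp] theorem mul_m (x y : UpperTriangular Λ M Γ) :
    (x * y).m = x.a • y.m + MulOpposite.op y.b • x.m := rfl
@[simp] theorem mul_b (x y : UpperTriangular Λ M Γ) : (x * y).b = x.b * y.b := rfl

/-- The upper triangular matrix ring of two rings and a bimodule. -/
instance [SMulCommClass Λ Γᵐᵒᵖ M] : Ring (UpperTriangular Λ M Γ) where
  __ := (inferInstance : AddCommGroup (UpperTriangular Λ M Γ))
  left_distrib x y z := by
    ext
    · simp [mul_add]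
    · simp only [mul_m, add_m, add_b, MulOpposite.op_add, smul_add, add_smul]
      abel
    · simp [mul_add]
  right_distrib x y z := by
    ext
    · simp [add_mul]
    · simp only [mul_m, add_m, add_a, smul_add, add_smul]
      abel
    · simp [add_mul]
  zero_mul x := by ext <;> simp
  mul_zero x := by ext <;> simp
  mul_assoc x y z := by
    ext
    · simp [mul_assoc]
    · simp [mul_smul, smul_comm, add_assoc]
    · simp [mul_assoc]
  one_mul x := by ext <;> simp
  mul_one x := by ext <;> simp

end UpperTriangular

end TriCM

open CategoryTheory
open scoped TensorProduct

namespace TriCM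

open MulOpposite (op)

/-! The proof replaces Gorenstein projective modules by totally acyclic complexes `K` of
projectives. A ring is strongly left CM-free exactly when `Hom(K, W)` is exact for every such `K`
and every module `W`, not only for projective `W`. Indeed, if all images of the differentials are
projective, then `K` is contractible. Conversely, exactness of `Hom(K, W)` with `W` an image splits
off that image.

The condition is transferred between rings along an `S`-`R`-bimodule `U` that is projective over `S`
(`StronglyLeftCMFree.homExact_coind`). By adjunction, maps from `U ⊗_R K` to `W` are maps from `K`
to `Hom_S(U, W)`. So if `Hom(K, -)` is exact on `Hom_S(U, F)` for free `F`, and on `Hom_ℤ(U, D)` for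
injective `D` (which says that `U ⊗_R K` is exact), then `U ⊗_R K` is totally acyclic. CM-freeness
of `S` then gives exactness on `Hom_S(U, W)` for every `W`.

From `Λ` and `Γ` to `T`: every `T`-module is an extension of a `Γ`-module by a `Λ`-module. The
transfer is applied to `U = Γ` and then to `U = Λ`, regarded as right `T`-modules. From `T` to `Λ`
and `Γ`: `U` is the first column `Λ` of `T`, respectively the last column `M ⊕ Γ`. Each is a
projective left `T`-module, and restricted modules `W` are recovered as retracts of `Hom_T(U, W)`.

In each case the modules to be tested are built by short exact sequences from modules already
handled. The finite projective dimension of `M` covers direct sums of copies of `M` as targets; the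
finite flat dimension covers `Hom_ℤ(M, D)`. -/

theorem exists_extend_range {S : Type v} [Ring S] {A L N : Type u} [AddCommGroup A] [Module S A]
    [AddCommGroup L] [Module S L] [AddCommGroup N] [Module S N] {p : L →ₗ[S] N} (f : L →ₗ[S] A)
    (hf : ∀ x, p x = 0 → f x = 0) :
    ∃ g : LinearMap.range p →ₗ[S] A, ∀ x, g ⟨p x, x, rfl⟩ = f x := by
  refine ⟨(LinearMap.ker p).liftQ f (fun x hx => hf x hx) ∘ₗ
    p.quotKerEquivRange.symm.toLinearMap, fun x => ?_⟩
  have : p.quotKerEquivRange.symm ⟨p x, x, rfl⟩ = (LinearMap.ker p).mkQ x :=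
    p.quotKerEquivRange.symm_apply_eq.2 rfl
  rw [LinearMap.comp_apply, LinearEquiv.coe_coe, this]
  exact Submodule.liftQ_apply _ _ _

/-! ### Exactness of `Hom(K, W)` as `W` varies -/

section HomExact

variable {R : Type u} [Ring R] {K : ℤ → Type u} [∀ i, AddCommGroup (K i)]
  [∀ i, Module R (K i)]

/-- The complex `Hom(K, W)` is exact. -/
def HomExact (d : ∀ i, K i →ₗ[R] K (i + 1)) (W : Type u) [AddCommGroup W] [Module R W] : Prop :=
  ∀ (i : ℤ) (f : K (i + 1) →ₗ[R] W), f ∘ₗ d i = 0 →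
    ∃ g : K (i + 1 + 1) →ₗ[R] W, g ∘ₗ d (i + 1) = f

variable {d : ∀ i, K i →ₗ[R] K (i + 1)}
variable {A B C : Type u} [AddCommGroup A] [AddCommGroup B] [AddCommGroup C]
  [Module R A] [Module R B] [Module R C]

theorem HomExact.of_retract (hB : HomExact d B) (ι : A →ₗ[R] B) (π : B →ₗ[R] A)
    (h : ∀ a, π (ι a) = a) : HomExact d A := by
  intro i f hf
  obtain ⟨g, hg⟩ := hB i (ι ∘ₗ f) (by rw [LinearMap.comp_assoc, hf, LinearMap.comp_zero])
  refine ⟨π ∘ₗ g, ?_⟩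
  rw [LinearMap.comp_assoc, hg]
  ext x
  simp [h]

theorem HomExact.of_equiv (hB : HomExact d B) (e : A ≃ₗ[R] B) : HomExact d A :=
  hB.of_retract e.toLinearMap e.symm.toLinearMap (by simp)

theorem HomExact.of_subsingleton [Subsingleton A] : HomExact d A :=
  fun _ _ _ => ⟨0, LinearMap.ext fun _ => Subsingleton.elim _ _⟩

theorem exists_comp_eq_of_exact {P : Type u} [AddCommGroup P] [Module R P]
    {ι : A →ₗ[R] B} {π : B →ₗ[R] C} (hι : Function.Injective ι) (h : Function.Exact ι π)
    (f : P →ₗ[R] B) (hf : π ∘ₗ f = 0) : ∃ g : P →ₗ[R] A, ι ∘ₗ g = f := by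
  refine ⟨(LinearEquiv.ofInjective ι hι).symm.toLinearMap ∘ₗ
    f.codRestrict (LinearMap.range ι) fun x => (h (f x)).1 (LinearMap.congr_fun hf x), ?_⟩
  ext x
  exact congrArg Subtype.val ((LinearEquiv.ofInjective ι hι).apply_symm_apply ⟨f x, _⟩)

theorem comp_left_cancel_of_injective {P : Type u} [AddCommGroup P] [Module R P]
    {ι : A →ₗ[R] B} (hι : Function.Injective ι) {f g : P →ₗ[R] A} (h : ι ∘ₗ f = ι ∘ₗ g) :
    f = g :=
  LinearMap.ext fun x => hι (LinearMap.congr_fun h x)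

section ShortExact

variable {ι : A →ₗ[R] B} {π : B →ₗ[R] C}

/-- This and the next two lemmas are two-out-of-three: since the terms of `K` are projective,
`Hom(K, -)` turns a short exact sequence of modules into one of complexes. The proofs are the
corresponding diagram chases. -/
theorem HomExact.middle (hK : ∀ i, Module.Projective R (K i)) (hd : ∀ i, d (i + 1) ∘ₗ d i = 0)
    (hι : Function.Injective ι) (h : Function.Exact ι π) (hπ : Function.Surjective π)
    (hA : HomExact d A) (hC : HomExact d C) : HomExact d B := by
  intro i f hf
  have hιπ : π ∘ₗ ι = 0 := LinearMap.ext fun x => h.apply_apply_eq_zero x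
  obtain ⟨g, hg⟩ := hC i (π ∘ₗ f) (by rw [LinearMap.comp_assoc, hf, LinearMap.comp_zero])
  obtain ⟨g', hg'⟩ := Module.projective_lifting_property π g hπ
  obtain ⟨k, hk⟩ := exists_comp_eq_of_exact hι h (f - g' ∘ₗ d (i + 1)) (by
    rw [LinearMap.comp_sub, ← LinearMap.comp_assoc, hg', hg, sub_self])
  obtain ⟨l, hl⟩ := hA i k (comp_left_cancel_of_injective hι (by
    rw [← LinearMap.comp_assoc, hk, LinearMap.sub_comp, LinearMap.comp_assoc, hd, hf]; simp))
  refine ⟨g' + ι ∘ₗ l, ?_⟩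
  rw [LinearMap.add_comp, LinearMap.comp_assoc, hl, hk, add_sub_cancel]

theorem HomExact.right (hK : ∀ i, Module.Projective R (K i)) (hd : ∀ i, d (i + 1) ∘ₗ d i = 0)
    (hι : Function.Injective ι) (h : Function.Exact ι π) (hπ : Function.Surjective π)
    (hA : HomExact d A) (hB : HomExact d B) : HomExact d C := by
  intro i f hf
  have hιπ : π ∘ₗ ι = 0 := LinearMap.ext fun x => h.apply_apply_eq_zero x
  -- The connecting map shifts degree: exactness for `A` is used one step before exactness for `B`.
  obtain ⟨i, rfl⟩ : ∃ j, i = j + 1 := ⟨i - 1, by ring⟩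
  obtain ⟨f', hf'⟩ := Module.projective_lifting_property π f hπ
  obtain ⟨k, hk⟩ := exists_comp_eq_of_exact hι h (f' ∘ₗ d (i + 1)) (by
    rw [← LinearMap.comp_assoc, hf', hf])
  obtain ⟨l, hl⟩ := hA i k (comp_left_cancel_of_injective hι (by
    rw [← LinearMap.comp_assoc, hk, LinearMap.comp_assoc, hd]; simp))
  obtain ⟨g, hg⟩ := hB (i + 1) (f' - ι ∘ₗ l) (by
    rw [LinearMap.sub_comp, LinearMap.comp_assoc, hl, hk, sub_self])
  refine ⟨π ∘ₗ g, ?_⟩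
  rw [LinearMap.comp_assoc, hg, LinearMap.comp_sub, hf', ← LinearMap.comp_assoc, hιπ]
  simp

theorem HomExact.left (hK : ∀ i, Module.Projective R (K i)) (hd : ∀ i, d (i + 1) ∘ₗ d i = 0)
    (hι : Function.Injective ι) (h : Function.Exact ι π) (hπ : Function.Surjective π)
    (hB : HomExact d B) (hC : HomExact d C) : HomExact d A := by
  intro i f hf
  have hιπ : π ∘ₗ ι = 0 := LinearMap.ext fun x => h.apply_apply_eq_zero x
  obtain ⟨g, hg⟩ := hB i (ι ∘ₗ f) (by rw [LinearMap.comp_assoc, hf, LinearMap.comp_zero])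
  obtain ⟨k, hk⟩ := hC (i + 1) (π ∘ₗ g) (by
    rw [LinearMap.comp_assoc, hg, ← LinearMap.comp_assoc, hιπ, LinearMap.zero_comp])
  obtain ⟨k', hk'⟩ := Module.projective_lifting_property π k hπ
  obtain ⟨l, hl⟩ := exists_comp_eq_of_exact hι h (g - k' ∘ₗ d (i + 1 + 1)) (by
    rw [LinearMap.comp_sub, ← LinearMap.comp_assoc, hk', hk, sub_self])
  refine ⟨l, comp_left_cancel_of_injective hι ?_⟩
  rw [← LinearMap.comp_assoc, hl, LinearMap.sub_comp, hg, LinearMap.comp_assoc, hd]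
  simp

end ShortExact

theorem HomExact.of_injective (hd : ∀ i, Function.Exact (d i) (d (i + 1)))
    [hA : Module.Injective R A] : HomExact d A := by
  intro i f hf
  obtain ⟨g, hg⟩ := exists_extend_range (p := d (i + 1)) f fun x hx => by
    obtain ⟨y, rfl⟩ := (hd i x).1 hx
    exact LinearMap.congr_fun hf y
  obtain ⟨k, hk⟩ := hA.out (LinearMap.range (d (i + 1))).subtype Subtype.val_injective g
  exact ⟨k, LinearMap.ext fun x => (hk ⟨_, x, rfl⟩).trans (hg x)⟩

/-- A section `s` of the next differential onto its projective image makes `1 - s d` a projection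
onto the kernel, which is the image of the previous differential. A map given on that image extends
along this projection. -/
theorem HomExact.of_projective_range (hd : ∀ i, Function.Exact (d i) (d (i + 1)))
    (hp : ∀ i, Module.Projective R (LinearMap.range (d i))) : HomExact d A := by
  intro i f hf
  obtain ⟨g, hg⟩ := exists_extend_range (p := d (i + 1)) f fun x hx => by
    obtain ⟨y, rfl⟩ := (hd i x).1 hx
    exact LinearMap.congr_fun hf y
  obtain ⟨s, hs⟩ := Module.projective_lifting_property (d (i + 1 + 1)).rangeRestrict
    LinearMap.id (d (i + 1 + 1)).surjective_rangeRestrict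
  have hs' (y) : d (i + 1 + 1) (s y) = y := congrArg Subtype.val (LinearMap.congr_fun hs y)
  have hr : ∀ x, (LinearMap.id (R := R) (M := K (i + 1 + 1)) - s ∘ₗ (d (i + 1 + 1)).rangeRestrict)
      x ∈
      LinearMap.range (d (i + 1)) := fun x => by
    refine (hd (i + 1) _).1 ?_
    simp [hs']
  refine ⟨g ∘ₗ LinearMap.codRestrict _ _ hr, LinearMap.ext fun x => ?_⟩
  rw [← hg x]
  refine congrArg g (Subtype.ext ?_)
  have : (d (i + 1 + 1)).rangeRestrict (d (i + 1) x) = 0 :=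
    Subtype.ext ((hd (i + 1)).apply_apply_eq_zero x)
  simp [this]

/-- The differential, corestricted to its image, is a cocycle with values in that image. Extending
it over the next term gives a retraction of the inclusion of the image into a projective module. -/
theorem projective_range_of_homExact (hK : ∀ i, Module.Projective R (K i))
    (hd : ∀ i, d (i + 1) ∘ₗ d i = 0) (i : ℤ)
    (h : HomExact d (LinearMap.range (d i))) : Module.Projective R (LinearMap.range (d i)) := by
  obtain ⟨i, rfl⟩ : ∃ j, i = j + 1 := ⟨i - 1, by ring⟩
  obtain ⟨g, hg⟩ := h i (d (i + 1)).rangeRestrict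
    (LinearMap.ext fun x => Subtype.ext (LinearMap.congr_fun (hd i) x))
  refine Module.Projective.of_split (LinearMap.range (d (i + 1))).subtype g ?_
  ext ⟨_, x, rfl⟩
  exact congrArg Subtype.val (LinearMap.congr_fun hg x)

variable (d) in
/-- Totally acyclic complexes of projective modules. -/
structure IsTotallyAcyclic : Prop where
  projective (i : ℤ) : Module.Projective R (K i)
  exact (i : ℤ) : Function.Exact (d i) (d (i + 1))
  homExact (P : Type u) [AddCommGroup P] [Module R P] [Module.Projective R P] : HomExact d P

theorem comp_eq_zero_of_exact (hd : ∀ i, Function.Exact (d i) (d (i + 1))) (i : ℤ) :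
    d (i + 1) ∘ₗ d i = 0 :=
  LinearMap.ext fun x => (hd i).apply_apply_eq_zero x

end HomExact

/-! ### CM-freeness in terms of totally acyclic complexes -/

section Bridge

variable {R : Type u} [Ring R]

/-- The cochain complex `i ↦ K (i + n)`, without signs. -/
def reindex (K : CochainComplex (ModuleCat.{u} R) ℤ) (n : ℤ) :
    CochainComplex (ModuleCat.{u} R) ℤ where
  X i := K.X (i + n)
  d i j := K.d (i + n) (j + n)
  shape i j h := K.shape _ _ fun h' => h (by
    have : i + n + 1 = j + n := h'
    change i + 1 = j
    omega)
  d_comp_d' i j k _ _ := K.d_comp_d _ _ _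

theorem exactAt_iff_function_exact (K : CochainComplex (ModuleCat.{u} R) ℤ) {i j k : ℤ}
    (hij : i + 1 = j) (hjk : j + 1 = k) :
    K.ExactAt j ↔ Function.Exact (K.d i j).hom (K.d j k).hom := by
  rw [K.exactAt_iff' i j k (by simp [← hij]) (by simp [hjk])]
  exact ShortComplex.ShortExact.moduleCat_exact_iff_function_exact _

/-- The definition sees only the image of the differential from degree `-1` to `0`; translating the
complex brings any other image there. -/
theorem StronglyLeftCMFree.projective_range (h : StronglyLeftCMFree R)
    {K : CochainComplex (ModuleCat.{u} R) ℤ} (hK : IsCompleteProjectiveResolution K)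
    (i j : ℤ) (hij : i + 1 = j) : Module.Projective R (LinearMap.range (K.d i j).hom) := by
  have hexact (i j k : ℤ) (hij : i + 1 = j) (hjk : j + 1 = k) :
      Function.Exact (K.d i j).hom (K.d j k).hom :=
    (exactAt_iff_function_exact K hij hjk).1 (hK.acyclic j)
  have hhom (P : ModuleCat.{u} R) (hP : Projective P) (i j k : ℤ) (hij : i + 1 = j)
      (hjk : j + 1 = k) (f : K.X j ⟶ P) (hf : K.d i j ≫ f = 0) :
      ∃ g : K.X k ⟶ P, K.d j k ≫ g = f := by
    subst hij hjk
    exact hK.hom_exact P hP i f hf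
  have hK' : IsCompleteProjectiveResolution (reindex K j) :=
    { projective := fun i => hK.projective _
      acyclic := fun l => (exactAt_iff_function_exact (i := l - 1) (k := l + 1) _ (by ring) rfl).2
        (hexact _ _ _ (by ring) (by ring))
      hom_exact := fun P hP l f hf => hhom P hP _ _ _ (by ring) (by ring) f hf }
  have hp := h _ ⟨_, hK', ⟨Iso.refl _⟩⟩
  have hp' := Projective.of_iso (ModuleCat.imageIsoRange ((reindex K j).d (-1) 0)) hp
  rw [← IsProjective.iff_projective] at hp'
  have h1 : (-1 : ℤ) + j = i := by omega
  have h2 : (0 : ℤ) + j = j := by omega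
  change Module.Projective R (LinearMap.range (K.d (-1 + j) (0 + j)).hom) at hp'
  rwa [h1, h2] at hp'

variable {K : ℤ → Type u} [∀ i, AddCommGroup (K i)] [∀ i, Module R (K i)]
  {d : ∀ i, K i →ₗ[R] K (i + 1)}

theorem StronglyLeftCMFree.homExact (h : StronglyLeftCMFree R) (hd : IsTotallyAcyclic d)
    (W : Type u) [AddCommGroup W] [Module R W] : HomExact d W := by
  have hdd := comp_eq_zero_of_exact hd.exact
  let C : CochainComplex (ModuleCat.{u} R) ℤ :=
    CochainComplex.of (fun i => ModuleCat.of R (K i)) (fun i => ModuleCat.ofHom (d i))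
      (fun i => by rw [← ModuleCat.ofHom_comp, hdd]; rfl)
  have hC (i : ℤ) : C.d i (i + 1) = ModuleCat.ofHom (d i) := 
    CochainComplex.of_d (fun i => ModuleCat.of R (K i)) (fun i => ModuleCat.ofHom (d i)) i
  have hC' : IsCompleteProjectiveResolution C :=
    { projective := fun i => by
        have := hd.projective i
        exact (IsProjective.iff_projective (K i)).1 this
      acyclic := fun i => by
        obtain ⟨i, rfl⟩ : ∃ j, i = j + 1 := ⟨i - 1, by ring⟩
        rw [exactAt_iff_function_exact C rfl rfl, hC, hC]
        exact hd.exact i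
      hom_exact := fun P hP i f hf => by
        have : Module.Projective R P := (IsProjective.iff_projective P).2 hP
        rw [hC] at hf ⊢
        obtain ⟨g, hg⟩ := hd.homExact P i f.hom
          (congrArg ModuleCat.Hom.hom hf)
        exact ⟨ModuleCat.ofHom g, ModuleCat.hom_ext hg⟩ }
  refine HomExact.of_projective_range hd.exact fun i => ?_
  have := h.projective_range hC' i _ rfl
  rwa [hC] at this

theorem stronglyLeftCMFree_of_homExact
    (h : ∀ (K : ℤ → Type u) [∀ i, AddCommGroup (K i)] [∀ i, Module R (K i)]
      (d : ∀ i, K i →ₗ[R] K (i + 1)), IsTotallyAcyclic d →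
      ∀ (W : Type u) [AddCommGroup W] [Module R W], HomExact d W) :
    StronglyLeftCMFree R := by
  rintro G ⟨C, hC, ⟨e⟩⟩
  have hT : IsTotallyAcyclic (R := R) (K := fun i => C.X i) fun i => (C.d i (i + 1)).hom :=
    { projective := fun i => (IsProjective.iff_projective _).2 (hC.projective i)
      exact := fun i => (exactAt_iff_function_exact C rfl rfl).1 (hC.acyclic _)
      homExact := fun P _ _ _ i f hf => by
        obtain ⟨g, hg⟩ := hC.hom_exact (ModuleCat.of R P)
          ((IsProjective.iff_projective P).1 ‹_›) i (ModuleCat.ofHom f)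
          (ModuleCat.hom_ext hf)
        exact ⟨g.hom, congrArg ModuleCat.Hom.hom hg⟩ }
  have hp := projective_range_of_homExact hT.projective (comp_eq_zero_of_exact hT.exact) (-1)
    (h _ _ hT _)
  change Module.Projective R (LinearMap.range (C.d (-1) 0).hom) at hp
  rw [IsProjective.iff_projective] at hp
  exact Projective.of_iso (e ≪≫ ModuleCat.imageIsoRange _).symm hp

end Bridge

/-! ### Restriction of scalars and coinduced modules -/

section Restr

variable {R S : Type u} [Ring R] [Ring S]

/-- The additive group `W` as an `R`-module by restriction of scalars along `σ : R → S`. -/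
def Restr (_ : R →+* S) (W : Type u) : Type u := W

namespace Restr

variable (σ : R →+* S) (W : Type u) [AddCommGroup W]

instance : AddCommGroup (Restr σ W) := inferInstanceAs (AddCommGroup W)

instance commuting {S' : Type u} [Ring S'] [Module S' W] :
    Module S' (Restr σ W) :=
  inferInstanceAs (Module S' W)

instance [Module S W] : Module R (Restr σ W) := Module.compHom W σ

instance {S' : Type u} [Ring S'] [Module S' W] [Module S W] [SMulCommClass S' S W] :
    SMulCommClass S' R (Restr σ W) :=
  ⟨fun s r w => smul_comm (M := S') (N := S) (α := W) s (σ r) w⟩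

instance {S' : Type u} [Ring S'] [Module S' W] [Module S W] [SMulCommClass S S' W] :
    SMulCommClass R S' (Restr σ W) :=
  ⟨fun r s w => smul_comm (M := S) (N := S') (α := W) (σ r) s w⟩

variable {W} {W' : Type u} [AddCommGroup W'] [Module S W'] [Module S W]

/-- Restriction of scalars on maps. -/
def map (f : W →ₗ[S] W') : Restr σ W →ₗ[R] Restr σ W' where
  toFun := f
  map_add' := f.map_add
  map_smul' r w := f.map_smul (σ r) w

end Restr

end Restr

section Coind

variable {R S U W : Type u} [Ring R]

/-- The `S`-linear maps `U → W`, as a left `R`-module by the right `R`-module structure of `U`. -/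
def Coind (S : Type v) (U W : Type u) [Ring S] [AddCommGroup U] [Module S U] [AddCommGroup W]
    [Module S W] : Type u := U →ₗ[S] W

namespace Coind

variable {S : Type v} [Ring S] {U W W' : Type u} [AddCommGroup U] [Module S U] [AddCommGroup W]
  [Module S W] [AddCommGroup W'] [Module S W'] [Module Rᵐᵒᵖ U]

instance : AddCommGroup (Coind S U W) := inferInstanceAs (AddCommGroup (U →ₗ[S] W))
instance : FunLike (Coind S U W) U W := inferInstanceAs (FunLike (U →ₗ[S] W) U W)
instance : LinearMapClass (Coind S U W) S U W :=
  inferInstanceAs (LinearMapClass (U →ₗ[S] W) S U W)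

@[ext] theorem ext {h h' : Coind S U W} (e : ∀ u, h u = h' u) : h = h' := LinearMap.ext e

@[simp] theorem add_apply (h h' : Coind S U W) (u : U) : (h + h') u = h u + h' u := rfl
@[simp] theorem zero_apply (u : U) : (0 : Coind S U W) u = 0 := rfl

/-- Construct an element of `Coind S U W` from a linear map. -/
def of (h : U →ₗ[S] W) : Coind S U W := h

@[simp] theorem of_apply (h : U →ₗ[S] W) (u : U) : of h u = h u := rfl

variable [SMulCommClass S Rᵐᵒᵖ U]

instance : SMul R (Coind S U W) :=
  ⟨fun r h =>
    { toFun u := h (op r • u)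
      map_add' u v := by rw [smul_add, map_add]
      map_smul' s u := by rw [← smul_comm, map_smul]; rfl }⟩

@[simp] theorem smul_apply (r : R) (h : Coind S U W) (u : U) : (r • h) u = h (op r • u) := rfl

instance : Module R (Coind S U W) where
  one_smul h := by ext u; simp
  mul_smul r r' h := by ext u; simp [mul_smul]
  smul_zero r := by ext u; simp
  smul_add r h h' := by ext u; simp
  add_smul r r' h := by ext u; simp [add_smul]
  zero_smul h := by ext u; simp

/-- Composition with a linear map on the left. -/
def map (f : W →ₗ[S] W') : Coind S U W →ₗ[R] Coind S U W' where
  toFun h := of (f ∘ₗ h)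
  map_add' h h' := by ext u; exact f.map_add _ _
  map_smul' r h := rfl

@[simp] theorem map_apply (f : W →ₗ[S] W') (h : Coind S U W) (u : U) :
    map (R := R) f h u = f (h u) := rfl

end Coind

variable {U U' U'' D : Type u} [AddCommGroup U] [AddCommGroup U'] [AddCommGroup U'']
  [Module Rᵐᵒᵖ U] [Module Rᵐᵒᵖ U'] [Module Rᵐᵒᵖ U''] [AddCommGroup D]

/-- Composition with a map of right `R`-modules on the right. -/
def Coind.precomp (D : Type u) [AddCommGroup D] (φ : U →ₗ[Rᵐᵒᵖ] U') :
    Coind ℤ U' D →ₗ[R] Coind ℤ U D where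
  toFun h := Coind.of (h ∘ₗ φ.toAddMonoidHom.toIntLinearMap)
  map_add' _ _ := rfl
  map_smul' r h := by
    ext u
    exact congrArg h (φ.map_smul (op r) u).symm

@[simp] theorem Coind.precomp_apply (φ : U →ₗ[Rᵐᵒᵖ] U') (h : Coind ℤ U' D) (u : U) :
    Coind.precomp D φ h u = h (φ u) := rfl

theorem Coind.precomp_injective {π : U →ₗ[Rᵐᵒᵖ] U'} (hπ : Function.Surjective π) :
    Function.Injective (Coind.precomp D π) := by
  intro h h' e
  ext u
  obtain ⟨u, rfl⟩ := hπ u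
  exact DFunLike.congr_fun e u

theorem Coind.precomp_exact {ι : U'' →ₗ[Rᵐᵒᵖ] U} {π : U →ₗ[Rᵐᵒᵖ] U'} (h : Function.Exact ι π)
    (hπ : Function.Surjective π) :
    Function.Exact (Coind.precomp D π) (Coind.precomp D ι) := by
  intro f
  constructor
  · intro hf
    let p : U →ₗ[ℤ] U' := π.toAddMonoidHom.toIntLinearMap
    obtain ⟨g, hg⟩ := exists_extend_range (S := ℤ) (p := p) (A := D) f fun x hx => by
      obtain ⟨y, rfl⟩ := (h x).1 hx
      exact DFunLike.congr_fun hf y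
    refine ⟨Coind.of (g ∘ₗ LinearMap.codRestrict (LinearMap.range p) LinearMap.id
      fun x => hπ x), ?_⟩
    ext u
    exact hg u
  · rintro ⟨g, rfl⟩
    ext u
    change g (π (ι u)) = 0
    rw [h.apply_apply_eq_zero, map_zero]

theorem Coind.precomp_surjective [hD : Module.Injective ℤ D] {ι : U'' →ₗ[Rᵐᵒᵖ] U}
    (hι : Function.Injective ι) : Function.Surjective (Coind.precomp D ι) := by
  intro f
  obtain ⟨g, hg⟩ := hD.out ι.toAddMonoidHom.toIntLinearMap hι f
  exact ⟨Coind.of g, Coind.ext hg⟩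

/-- Evaluation at `1` identifies `R`-linear maps into `Hom_ℤ(R, D)` with additive maps into `D`, and
these extend along injections. -/
instance Coind.injective_regular [hD : Module.Injective ℤ D] :
    Module.Injective R (Coind ℤ R D) := by
  refine ⟨fun X Y _ _ _ _ f hf g => ?_⟩
  let ev : Coind ℤ R D →ₗ[ℤ] D :=
    { toFun h := h 1, map_add' _ _ := rfl, map_smul' _ _ := rfl }
  obtain ⟨k, hk⟩ := hD.out f.toAddMonoidHom.toIntLinearMap hf
    (ev ∘ₗ g.toAddMonoidHom.toIntLinearMap)
  refine ⟨
    { toFun y := Coind.of (k ∘ₗ (LinearMap.toSpanSingleton R Y y).toAddMonoidHom.toIntLinearMap)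
      map_add' y y' := by
        ext r
        change k (r • (y + y')) = k (r • y) + k (r • y')
        rw [smul_add, map_add]
      map_smul' r y := by
        ext s
        change k (s • r • y) = k ((s * r) • y)
        rw [mul_smul] }, fun x => ?_⟩
  ext r
  change k (r • f x) = _
  rw [← f.map_smul]
  refine (hk (r • x)).trans ?_
  change g (r • x) 1 = _
  rw [g.map_smul, Coind.smul_apply]
  simp

end Coind

/-! ### Balanced tensor products and the tensor-hom adjunction -/

section Tensor

variable {R : Type u} {S : Type v} {U N N' W D : Type u} [Ring R] [Ring S]
  [AddCommGroup U] [Module Rᵐᵒᵖ U]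
  [Module S U] [SMulCommClass S Rᵐᵒᵖ U] [AddCommGroup N] [Module R N] [AddCommGroup N']
  [Module R N'] [AddCommGroup W] [Module S W] [AddCommGroup D]

/-- The pure tensor `u ⊗ n` in `U ⊗_R N`. -/
def balancedTmul (R : Type u) [Ring R] {U N : Type u} [AddCommGroup U] [Module Rᵐᵒᵖ U]
    [AddCommGroup N] [Module R N] (u : U) (n : N) : BalancedTensor R U N :=
  QuotientAddGroup.mk (u ⊗ₜ[ℤ] n)

theorem balancedTensor_addHom_ext {f g : BalancedTensor R U N →+ D}
    (h : ∀ u n, f (balancedTmul R u n) = g (balancedTmul R u n)) : f = g := by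
  refine QuotientAddGroup.addMonoidHom_ext _ ?_
  refine AddMonoidHom.ext fun x => ?_
  induction x using TensorProduct.induction_on with
  | zero => simp only [map_zero]
  | tmul u n => exact h u n
  | add x y hx hy => rw [map_add, map_add, hx, hy]

theorem balancedTmul_add_left (u u' : U) (n : N) :
    balancedTmul R (u + u') n = balancedTmul R u n + balancedTmul R u' n :=
  congrArg (QuotientAddGroup.mk (s := balancedRelations R U N)) (TensorProduct.add_tmul u u' n)

theorem balancedTmul_add_right (u : U) (n n' : N) :
    balancedTmul R u (n + n') = balancedTmul R u n + balancedTmul R u n' :=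
  congrArg (QuotientAddGroup.mk (s := balancedRelations R U N)) (TensorProduct.tmul_add u n n')

theorem balancedTmul_smul (r : R) (u : U) (n : N) :
    balancedTmul R u (r • n) = balancedTmul R (op r • u) n :=
  ((QuotientAddGroup.eq_iff_sub_mem (N := balancedRelations R U N)).2
    (AddSubgroup.subset_closure ⟨u, r, n, rfl⟩)).symm

/-- The additive map on `U ⊗_R N` given by a linear map from `N` to the `R`-module of maps
`U → W`. -/
def balancedLift (φ : N →ₗ[R] Coind S U W) : BalancedTensor R U N →+ W :=
  QuotientAddGroup.lift _
    (TensorProduct.liftAddHom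
      (AddMonoidHom.flip
        { toFun n := LinearMap.toAddMonoidHom (φ n)
          map_zero' := by rw [map_zero]; rfl
          map_add' n n' := by rw [map_add]; rfl })
      (fun r u n => by
        change φ n (r • u) = φ (r • n) u
        rw [map_zsmul, map_zsmul]; rfl)) <| (AddSubgroup.closure_le _).2 (by
    rintro _ ⟨u, r, n, rfl⟩
    change _ = _
    rw [map_sub, TensorProduct.liftAddHom_tmul, TensorProduct.liftAddHom_tmul]
    change φ n (op r • u) - φ (r • n) u = 0
    rw [φ.map_smul, Coind.smul_apply, sub_self])

@[simp] theorem balancedLift_balancedTmul (φ : N →ₗ[R] Coind S U W) (u : U) (n : N) :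
    balancedLift φ (balancedTmul R u n) = φ n u := rfl

/-- The linear map from `N` to the `R`-module of additive maps `U → D` given by an additive map
on `U ⊗_R N`. -/
def balancedCurry (χ : BalancedTensor R U N →+ D) : N →ₗ[R] Coind ℤ U D where
  toFun n := Coind.of <| AddMonoidHom.toIntLinearMap
    (AddMonoidHom.mk' (fun u => χ (balancedTmul R u n)) fun u u' => by
      rw [balancedTmul_add_left, map_add])
  map_add' n n' := by
    ext u
    change χ (balancedTmul R u (n + n')) = χ (balancedTmul R u n) + χ (balancedTmul R u n')
    rw [balancedTmul_add_right, map_add]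
  map_smul' r n := by
    ext u
    exact congrArg χ (balancedTmul_smul r u n)

@[simp] theorem balancedCurry_apply (χ : BalancedTensor R U N →+ D) (u : U) (n : N) :
    balancedCurry χ n u = χ (balancedTmul R u n) := rfl

/-- Maps from `X` to `Hom_ℤ(U, D)` are additive maps `U ⊗_R X → D`. Flatness keeps `U ⊗_R f`
injective, and injectivity of `D` extends along it. -/
theorem injective_coind_of_isFlatRight (hU : IsFlatRight R U) [hD : Module.Injective ℤ D] :
    Module.Injective R (Coind ℤ U D) := by
  refine ⟨fun X Y _ _ _ _ f hf g => ?_⟩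
  obtain ⟨k, hk⟩ := hD.out (balancedTensorMap R U f).toIntLinearMap (hU _ _ f hf)
    (balancedLift g).toIntLinearMap
  refine ⟨balancedCurry k.toAddMonoidHom, fun x => ?_⟩
  ext u
  exact hk (balancedTmul R u x)

theorem exists_injective_addGroup (A : Type u) [AddCommGroup A] :
    ∃ (D : Type u) (_ : AddCommGroup D) (_ : Module.Injective ℤ D) (f : A →+ D),
      Function.Injective f := by
  let X := Injective.under (ModuleCat.of ℤ A)
  have : Module.Injective ℤ X := (Module.injective_iff_injective_object ℤ X).2
    (inferInstanceAs (Injective (Injective.under (ModuleCat.of ℤ A))))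
  let f : ModuleCat.of ℤ A ⟶ X := Injective.ι (ModuleCat.of ℤ A)
  refine ⟨X, inferInstance, ?_, f.hom.toAddMonoidHom, (ModuleCat.mono_iff_injective f).1
    (inferInstanceAs (Mono (Injective.ι (ModuleCat.of ℤ A))))⟩
  -- The two `ℤ`-module structures on `X` coincide, since an additive group carries only one.
  convert this
  exact Subsingleton.elim _ _

section SModule

instance balancedTensorModule : Module S (BalancedTensor R U N) :=
  let act (s : S) : BalancedTensor R U N →+ BalancedTensor R U N :=
    QuotientAddGroup.map _ _ (DistribSMul.toAddMonoidHom (U ⊗[ℤ] N) s) (by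
      refine (AddSubgroup.closure_le _).2 ?_
      rintro _ ⟨u, r, n, rfl⟩
      refine AddSubgroup.subset_closure ⟨s • u, r, n, ?_⟩
      refine (smul_sub s ((op r • u) ⊗ₜ[ℤ] n) (u ⊗ₜ[ℤ] (r • n))).trans ?_
      rw [TensorProduct.smul_tmul', TensorProduct.smul_tmul', smul_comm])
  { smul s x := act s x
    one_smul x := by
      induction x using QuotientAddGroup.induction_on with | H x =>
      exact congrArg QuotientAddGroup.mk (one_smul S x)
    mul_smul s t x := by
      induction x using QuotientAddGroup.induction_on with | H x =>
      exact congrArg QuotientAddGroup.mk (mul_smul s t x)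
    smul_zero s := (act s).map_zero
    smul_add s := (act s).map_add
    add_smul s t x := by
      induction x using QuotientAddGroup.induction_on with | H x =>
      exact congrArg QuotientAddGroup.mk (add_smul s t x)
    zero_smul x := by
      induction x using QuotientAddGroup.induction_on with | H x =>
      exact congrArg QuotientAddGroup.mk (zero_smul S x) }

/-- An additive map on `U ⊗_R N` that is linear on pure tensors is linear. -/
def balancedLinear (f : BalancedTensor R U N →+ W)
    (h : ∀ (s : S) u n, f (balancedTmul R (s • u) n) = s • f (balancedTmul R u n)) :
    BalancedTensor R U N →ₗ[S] W where
  toFun := f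
  map_add' := f.map_add
  map_smul' s x := DFunLike.congr_fun (balancedTensor_addHom_ext
    (f := f.comp (DistribSMul.toAddMonoidHom _ s)) (g := (DistribSMul.toAddMonoidHom _ s).comp f)
    (h s)) x

theorem balancedTensor_linear_ext {f g : BalancedTensor R U N →ₗ[S] W}
    (h : ∀ u n, f (balancedTmul R u n) = g (balancedTmul R u n)) : f = g :=
  LinearMap.toAddMonoidHom_injective (balancedTensor_addHom_ext h)

variable (S U) in
/-- The linear map `U ⊗_R f`. -/
def balancedMap (f : N →ₗ[R] N') : BalancedTensor R U N →ₗ[S] BalancedTensor R U N' :=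
  balancedLinear (balancedTensorMap R U f) fun _ _ _ => rfl

/-- The universal property of `U ⊗_R N`: from right to left. -/
def balancedUncurry (φ : N →ₗ[R] Coind S U W) : BalancedTensor R U N →ₗ[S] W :=
  balancedLinear (balancedLift φ) fun s u n => map_smul (φ n) s u

/-- The universal property of `U ⊗_R N`: from left to right. -/
def balancedLinearCurry (ψ : BalancedTensor R U N →ₗ[S] W) : N →ₗ[R] Coind S U W where
  toFun n := Coind.of
    { toFun u := ψ (balancedTmul R u n)
      map_add' u u' := by rw [balancedTmul_add_left, map_add]
      map_smul' s u := ψ.map_smul s (balancedTmul R u n) }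
  map_add' n n' := by
    ext u
    change ψ (balancedTmul R u (n + n')) = ψ (balancedTmul R u n) + ψ (balancedTmul R u n')
    rw [balancedTmul_add_right, map_add]
  map_smul' r n := by
    ext u
    exact congrArg ψ (balancedTmul_smul r u n)

/-- The functor `Hom_S(U ⊗_R N, -)` is `Hom_R(N, Hom_S(U, -))`, a composite of two functors that
preserve surjections. -/
theorem projective_balancedTensor {S : Type u} [Ring S] [Module S U] [SMulCommClass S Rᵐᵒᵖ U]
    [Module.Projective S U] [Module.Projective R N] :
    Module.Projective S (BalancedTensor R U N) := by
  refine Module.Projective.of_lifting_property'' fun π hπ => ?_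
  have hs : Function.Surjective (Coind.map (R := R) (U := U) π) := fun h => by
    obtain ⟨g, hg⟩ := Module.projective_lifting_property π h hπ
    exact ⟨Coind.of g, hg⟩
  obtain ⟨g, hg⟩ := Module.projective_lifting_property _
    (balancedLinearCurry (R := R) (U := U) (N := N) (S := S) LinearMap.id) hs
  refine ⟨balancedUncurry g, balancedTensor_linear_ext fun u n => ?_⟩
  exact DFunLike.congr_fun (LinearMap.congr_fun hg n) u

end SModule

end Tensor

theorem finsupp_mapRange_exact {I A B C : Type*} [AddCommGroup A] [AddCommGroup B] [AddCommGroup C]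
    {f : A → B} {g : B → C} (hf : f 0 = 0) (hg : g 0 = 0) (h : Function.Exact f g) :
    Function.Exact (Finsupp.mapRange (α := I) f hf) (Finsupp.mapRange g hg) := by
  intro x
  change _ ↔ x ∈ Set.range (Finsupp.mapRange f hf)
  rw [Finsupp.range_mapRange, Finsupp.ext_iff]
  exact forall_congr' fun i => h (x i)

/-! ### Transfer of total acyclicity along a bimodule -/

section Criteria

variable {R : Type u} [Ring R] {K : ℤ → Type u} [∀ i, AddCommGroup (K i)]
  [∀ i, Module R (K i)] {d : ∀ i, K i →ₗ[R] K (i + 1)}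

section

variable {S : Type u} [Ring S] {U W : Type u} [AddCommGroup U] [Module S U] [Module Rᵐᵒᵖ U]
  [SMulCommClass S Rᵐᵒᵖ U] [AddCommGroup W] [Module S W]

theorem HomExact.coind (h : HomExact (fun i => balancedMap S U (d i)) W) :
    HomExact d (Coind S U W) := by
  intro i f hf
  obtain ⟨g, hg⟩ := h i (balancedUncurry f) (balancedTensor_linear_ext fun u n =>
    DFunLike.congr_fun (LinearMap.congr_fun hf n) u)
  refine ⟨balancedLinearCurry g, ?_⟩
  ext n u
  exact LinearMap.congr_fun hg (balancedTmul R u n)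

theorem HomExact.of_coind (h : HomExact d (Coind S U W)) :
    HomExact (fun i => balancedMap S U (d i)) W := by
  intro i f hf
  obtain ⟨g, hg⟩ := h i (balancedLinearCurry f) (by
    ext n u
    exact LinearMap.congr_fun hf (balancedTmul R u n))
  exact ⟨balancedUncurry g, balancedTensor_linear_ext fun u n =>
    DFunLike.congr_fun (LinearMap.congr_fun hg n) u⟩

-- Injective abelian groups detect exactness: the cokernel of `U ⊗ d i` embeds in some injective
-- `D`. The resulting additive map `χ` to `D` kills the image, hence factors through the next
-- differential, hence kills the kernel. So the kernel lies in the image.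
variable (S) in
theorem exact_balancedMap (hd : ∀ i, d (i + 1) ∘ₗ d i = 0)
    (h : ∀ (D : Type u) [AddCommGroup D] [Module.Injective ℤ D], HomExact d (Coind ℤ U D))
    (i : ℤ) : Function.Exact (balancedMap S U (d i)) (balancedMap S U (d (i + 1))) := by
  have hcomp : (balancedMap S U (d (i + 1))) ∘ₗ (balancedMap S U (d i)) = 0 :=
    balancedTensor_linear_ext fun u n => by
      change balancedTmul R u ((d (i + 1) ∘ₗ d i) n) = 0
      rw [hd]
      exact congrArg (QuotientAddGroup.mk (s := balancedRelations R U _))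
        (TensorProduct.tmul_zero _ u)
  intro x
  refine ⟨fun hx => ?_, ?_⟩
  · let q := (LinearMap.range (balancedMap S U (d i))).mkQ
    obtain ⟨D, _, _, f, hf⟩ := exists_injective_addGroup
      (BalancedTensor R U (K (i + 1)) ⧸ LinearMap.range (balancedMap S U (d i)))
    let χ : BalancedTensor R U (K (i + 1)) →+ D := f.comp q.toAddMonoidHom
    have hχ (y) : χ (balancedMap S U (d i) y) = 0 := by
      exact (congrArg f ((Submodule.Quotient.mk_eq_zero _).2 (LinearMap.mem_range_self _ y))).trans
        f.map_zero
    obtain ⟨g, hg⟩ := h D i (balancedCurry χ) (by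
      ext n u
      exact hχ (balancedTmul R u n))
    have hg' : (balancedLift g).comp (balancedMap S U (d (i + 1))).toAddMonoidHom = χ :=
      balancedTensor_addHom_ext fun u n => DFunLike.congr_fun (LinearMap.congr_fun hg n) u
    have h0 : χ x = 0 := by
      rw [← hg']
      change balancedLift g (balancedMap S U (d (i + 1)) x) = 0
      rw [hx, map_zero]
    exact (Submodule.Quotient.mk_eq_zero _).1 (hf (h0.trans f.map_zero.symm))
  · rintro ⟨y, rfl⟩
    exact LinearMap.congr_fun hcomp y

end

theorem StronglyLeftCMFree.homExact_coind {S : Type u} [Ring S] (hS : StronglyLeftCMFree S)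
    {U : Type u} [AddCommGroup U] [Module S U] [Module Rᵐᵒᵖ U] [SMulCommClass S Rᵐᵒᵖ U]
    (hK : ∀ i, Module.Projective R (K i)) (hd : ∀ i, d (i + 1) ∘ₗ d i = 0)
    (hU : Module.Projective S U)
    (hfree : ∀ I : Type u, HomExact d (Coind S U (I →₀ S)))
    (hinj : ∀ (D : Type u) [AddCommGroup D] [Module.Injective ℤ D], HomExact d (Coind ℤ U D))
    (W : Type u) [AddCommGroup W] [Module S W] : HomExact d (Coind S U W) := by
  refine HomExact.coind (hS.homExact (d := fun i => balancedMap S U (d i)) ⟨fun i => ?_, ?_, ?_⟩ W)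
  · exact projective_balancedTensor
  · exact exact_balancedMap S hd hinj
  · intro P _ _ hP
    -- A projective `P` is a retract of the free module on its own underlying set, so free test
    -- modules suffice.
    obtain ⟨s, hs⟩ := hP.out
    exact (hfree P).of_coind.of_retract s (Finsupp.linearCombination S id) hs

/-- Applying `Hom_ℤ(-, D)` to a flat resolution of `M` gives a finite coresolution of `Hom_ℤ(M, D)`
by injectives, on which `Hom(K, -)` is exact; dimension shifting does the rest. -/
theorem homExact_coind_of_hasFiniteFlatDimensionRight {M : Type u} [AddCommGroup M]
    [Module Rᵐᵒᵖ M] (hM : HasFiniteFlatDimensionRight R M)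
    (hK : ∀ i, Module.Projective R (K i)) (hd : ∀ i, Function.Exact (d i) (d (i + 1)))
    (D : Type u) [AddCommGroup D] [Module.Injective ℤ D] : HomExact d (Coind ℤ M D) := by
  obtain ⟨n, F, δ, ε, hF, hn, hε, h0, hδ⟩ := hM
  -- The induction runs on a bound from which all `F i` vanish. At bound `0` the surjection from `F
  -- 0 = 0` forces `M = 0`.
  replace hn : ∀ i, n + 1 ≤ i → Subsingleton (F i) := hn
  generalize n + 1 = m at hn
  clear n
  have hFi (i : ℕ) : HomExact d (Coind ℤ (F i) D) := by
    have := injective_coind_of_isFlatRight (D := D) (hF i)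
    exact HomExact.of_injective hd
  induction m generalizing M F with
  | zero =>
    have := hn 0 le_rfl
    have hM : Subsingleton M := hε.subsingleton
    have : Subsingleton (Coind ℤ M D) := ⟨fun f g => Coind.ext fun u => by
      rw [Subsingleton.elim u 0, map_zero, map_zero]⟩
    exact HomExact.of_subsingleton
  | succ m ih =>
    have hδ0 (x) : δ 0 x ∈ LinearMap.ker ε := h0.apply_apply_eq_zero x
    have hker : HomExact d (Coind ℤ (LinearMap.ker ε) D) := by
      -- The resolution with its first term removed resolves the kernel of `ε`, with a bound smaller
      -- by one.
      refine ih (fun i => F (i + 1)) (fun i => δ (i + 1)) ((δ 0).codRestrict _ hδ0)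
        (fun i => hF _) ?_ ?_ (fun i => hδ _) (fun i hi => hn _ (by omega)) (fun i => hFi _)
      · rintro ⟨x, hx⟩
        obtain ⟨y, rfl⟩ := (h0 x).1 hx
        exact ⟨y, rfl⟩
      · intro x
        rw [← hδ 0 x]
        exact Subtype.ext_iff
    have hex : Function.Exact (LinearMap.ker ε).subtype ε := LinearMap.exact_subtype_ker_map ε
    exact HomExact.left hK (comp_eq_zero_of_exact hd) (Coind.precomp_injective hε)
      (Coind.precomp_exact hex hε) (Coind.precomp_surjective Subtype.val_injective)
      (hFi 0) hker

/-- Dimension shifting along `0 → ker π → S^(X) → X → 0`. Direct sums over `I` are carried along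
because the transfer criterion tests free modules of arbitrary rank. -/
theorem homExact_restr_of_hasFiniteProjectiveDimension {S : Type u} [Ring S] (σ : R →+* S)
    (hK : ∀ i, Module.Projective R (K i)) (hd : ∀ i, d (i + 1) ∘ₗ d i = 0)
    (hfree : ∀ I : Type u, HomExact d (Restr σ (I →₀ S)))
    {X : Type u} [AddCommGroup X] [Module S X] (hX : HasFiniteProjectiveDimension S X)
    (I : Type u) : HomExact d (Restr σ (I →₀ X)) := by
  have hproj (P : Type u) [AddCommGroup P] [Module S P] [hP : Module.Projective S P] :
      HomExact d (Restr σ P) := by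
    obtain ⟨s, hs⟩ := hP.out
    exact (hfree P).of_retract (Restr.map σ s) (Restr.map σ (Finsupp.linearCombination S id)) hs
  obtain ⟨n, hn⟩ := hX
  induction n generalizing X with
  | zero =>
    have : Module.Projective S X :=
      (IsProjective.iff_projective X).2 ((projective_iff_hasProjectiveDimensionLE_zero _).2 hn)
    classical
    have : Module.Projective S (I →₀ X) := .of_equiv (finsuppLequivDFinsupp S).symm
    exact hproj _
  | succ n ih =>
    let π : (X →₀ S) →ₗ[S] X := Finsupp.linearCombination S id
    have hπ : Function.Surjective π := Finsupp.linearCombination_surjective _ Function.surjective_id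
    have hex : Function.Exact (LinearMap.ker π).subtype π := LinearMap.exact_subtype_ker_map π
    have hT := LinearMap.shortExact_shortComplexKer hπ
    have hP : Projective (ModuleCat.of S (X →₀ S)) :=
      (IsProjective.iff_projective (X →₀ S)).1 inferInstance
    have hker := ih (X := LinearMap.ker π) ((hT.hasProjectiveDimensionLT_X₃_iff n hP).1 hn)
    refine HomExact.right hK hd
      (ι := Restr.map σ (Finsupp.mapRange.linearMap (LinearMap.ker π).subtype))
      (π := Restr.map σ (Finsupp.mapRange.linearMap π)) ?_ ?_ ?_ hker (hproj (I →₀ X →₀ S))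
    · exact Finsupp.mapRange_injective _ rfl Subtype.val_injective
    · exact finsupp_mapRange_exact rfl (map_zero π) hex
    · exact Finsupp.mapRange_surjective _ (map_zero π) hπ

end Criteria

/-! ### The transfer criterion for a ring homomorphism -/

section RestrCoind

variable {R S : Type u} [Ring R] [Ring S] (σ : R →+* S)

/-- The maps from `S` to `W` as an `R`-module are the restriction of scalars of `W`. -/
def restrEquivCoind (W : Type u) [AddCommGroup W] [Module S W] :
    Restr σ W ≃ₗ[R] Coind S (Restr (RingHom.op σ) S) W where
  toFun w := Coind.of (LinearMap.toSpanSingleton S W w)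
  invFun h := h (1 : S)
  map_add' w w' := Coind.ext fun s : S => smul_add (A := W) s w w'
  map_smul' r w := Coind.ext fun s : S => (mul_smul (α := S) (β := W) s (σ r) w).symm
  left_inv w := one_smul S (show W from w)
  right_inv h := Coind.ext fun s : S =>
    (map_smul h s (1 : S)).symm.trans (congrArg h (mul_one s))

/-- Restriction of scalars commutes with `Coind ℤ - D`. -/
def coindRestrEquiv (V D : Type u) [AddCommGroup V] [Module Sᵐᵒᵖ V] [AddCommGroup D] :
    Coind ℤ (Restr (RingHom.op σ) V) D ≃ₗ[R] Restr σ (Coind ℤ V D) where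
  toFun h := Coind.of (W := D) (U := V)
    (AddMonoidHom.toIntLinearMap (AddMonoidHom.mk' (fun v : V => h v) (map_add h)))
  invFun h := Coind.of (W := D) (U := Restr (RingHom.op σ) V)
    (AddMonoidHom.toIntLinearMap (AddMonoidHom.mk' (fun v : V => (show Coind ℤ V D from h) v)
      (map_add (show Coind ℤ V D from h))))
  map_add' _ _ := rfl
  map_smul' _ _ := rfl
  left_inv _ := rfl
  right_inv _ := rfl

variable {K : ℤ → Type u} [∀ i, AddCommGroup (K i)] [∀ i, Module R (K i)]
  {d : ∀ i, K i →ₗ[R] K (i + 1)}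

-- The transfer along `U = S`, with right action through `σ`: here `Hom_S(S, W)` is just `W`
-- restricted to `R`.
variable {σ} in
theorem StronglyLeftCMFree.homExact_restr (hS : StronglyLeftCMFree S)
    (hK : ∀ i, Module.Projective R (K i)) (hd : ∀ i, d (i + 1) ∘ₗ d i = 0)
    (hfree : ∀ I : Type u, HomExact d (Restr σ (I →₀ S)))
    (hinj : ∀ (D : Type u) [AddCommGroup D] [Module.Injective ℤ D],
      HomExact d (Coind ℤ (Restr (RingHom.op σ) S) D))
    (W : Type u) [AddCommGroup W] [Module S W] : HomExact d (Restr σ W) :=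
  (hS.homExact_coind (U := Restr (RingHom.op σ) S) hK hd
    (inferInstanceAs (Module.Projective S S))
    (fun I => (hfree I).of_equiv (restrEquivCoind σ _).symm) hinj W).of_equiv (restrEquivCoind σ W)

theorem homExact_restr_prod (hK : ∀ i, Module.Projective R (K i))
    (hd : ∀ i, d (i + 1) ∘ₗ d i = 0) (hfree : ∀ I : Type u, HomExact d (Restr σ (I →₀ S)))
    {M : Type u} [AddCommGroup M] [Module S M] (hM : HasFiniteProjectiveDimension S M)
    (I : Type u) : HomExact d (Restr σ (I →₀ S × M)) := by
  refine HomExact.middle hK hd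
    (ι := Restr.map σ (Finsupp.mapRange.linearMap (LinearMap.inl S S M)))
    (π := Restr.map σ (Finsupp.mapRange.linearMap (LinearMap.snd S S M))) ?_ ?_ ?_ (hfree I)
    (homExact_restr_of_hasFiniteProjectiveDimension σ hK hd hfree hM I)
  · exact Finsupp.mapRange_injective _ rfl LinearMap.inl_injective
  · exact finsupp_mapRange_exact rfl rfl Function.Exact.inl_snd
  · exact Finsupp.mapRange_surjective _ rfl LinearMap.snd_surjective

end RestrCoind

/-! ### From the diagonal rings to the triangular ring -/

namespace UpperTriangular

variable {Λ M Γ : Type u} [Ring Λ] [Ring Γ] [AddCommGroup M] [Module Λ M] [Module Γᵐᵒᵖ M]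
  [SMulCommClass Λ Γᵐᵒᵖ M]

variable (Λ M Γ) in
/-- The upper left entry. -/
def aHom : UpperTriangular Λ M Γ →+* Λ where
  toFun := a
  map_zero' := rfl
  map_one' := rfl
  map_add' _ _ := rfl
  map_mul' _ _ := rfl

variable (Λ M Γ) in
/-- The lower right entry. -/
def bHom : UpperTriangular Λ M Γ →+* Γ where
  toFun := b
  map_zero' := rfl
  map_one' := rfl
  map_add' _ _ := rfl
  map_mul' _ _ := rfl

variable (Λ M Γ) in
/-- The inclusion of the first row. -/
def rowHom : Λ × M →+ UpperTriangular Λ M Γ where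
  toFun p := ⟨p.1, p.2, 0⟩
  map_zero' := rfl
  map_add' p q := by ext <;> simp

variable (Λ M Γ) in
/-- The inclusion of the upper left corner. -/
def cornerHom : Λ →+ UpperTriangular Λ M Γ where
  toFun x := ⟨x, 0, 0⟩
  map_zero' := rfl
  map_add' p q := by ext <;> simp

/-- The inclusion of the free modules on the upper left corner. -/
noncomputable def finsuppCorner (I : Type u) :
    Restr (aHom Λ M Γ) (I →₀ Λ) →ₗ[UpperTriangular Λ M Γ] (I →₀ UpperTriangular Λ M Γ) where
  toFun x := Finsupp.mapRange.addMonoidHom (cornerHom Λ M Γ) (x : I →₀ Λ)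
  map_add' x y := map_add (Finsupp.mapRange.addMonoidHom (cornerHom Λ M Γ)) (x : I →₀ Λ) y
  map_smul' t := fun x : I →₀ Λ => Finsupp.ext fun i => by
    change (⟨t.a * x i, 0, 0⟩ : UpperTriangular Λ M Γ) = t * ⟨x i, 0, 0⟩
    ext <;> simp

/-- The projection of free modules to the upper left corner. -/
noncomputable def finsuppA (I : Type u) :
    (I →₀ UpperTriangular Λ M Γ) →ₗ[UpperTriangular Λ M Γ] Restr (aHom Λ M Γ) (I →₀ Λ) where
  toFun x := Finsupp.mapRange.addMonoidHom (aHom Λ M Γ).toAddMonoidHom x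
  map_add' x y := map_add (Finsupp.mapRange.addMonoidHom (aHom Λ M Γ).toAddMonoidHom) x y
  map_smul' _ _ := Finsupp.ext fun _ => rfl

/-- The projection of free modules to the lower right corner. -/
noncomputable def finsuppB (I : Type u) :
    (I →₀ UpperTriangular Λ M Γ) →ₗ[UpperTriangular Λ M Γ] Restr (bHom Λ M Γ) (I →₀ Γ) where
  toFun x := Finsupp.mapRange.addMonoidHom (bHom Λ M Γ).toAddMonoidHom x
  map_add' x y := map_add (Finsupp.mapRange.addMonoidHom (bHom Λ M Γ).toAddMonoidHom) x y
  map_smul' _ _ := Finsupp.ext fun _ => rfl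

/-- The inclusion of the first row of free modules. -/
noncomputable def finsuppRow (I : Type u) :
    Restr (aHom Λ M Γ) (I →₀ Λ × M) →ₗ[UpperTriangular Λ M Γ] (I →₀ UpperTriangular Λ M Γ) where
  toFun x := Finsupp.mapRange.addMonoidHom (rowHom Λ M Γ) (x : I →₀ Λ × M)
  map_add' x y := map_add (Finsupp.mapRange.addMonoidHom (rowHom Λ M Γ)) (x : I →₀ Λ × M) y
  map_smul' t := fun x : I →₀ Λ × M => Finsupp.ext fun i => by
    change (⟨t.a * (x i).1, t.a • (x i).2, 0⟩ : UpperTriangular Λ M Γ) = t * ⟨(x i).1, (x i).2, 0⟩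
    ext <;> simp

theorem projective_restr_a (I : Type u) :
    Module.Projective (UpperTriangular Λ M Γ) (Restr (aHom Λ M Γ) (I →₀ Λ)) :=
  Module.Projective.of_split (finsuppCorner I) (finsuppA I)
    (LinearMap.ext fun _ => Finsupp.ext fun _ => rfl)

/-- The lower right corner, as a right ideal. -/
def rightB : Restr (RingHom.op (bHom Λ M Γ)) Γ →ₗ[(UpperTriangular Λ M Γ)ᵐᵒᵖ]
    UpperTriangular Λ M Γ where
  toFun x := ⟨0, 0, x⟩
  map_add' x y := by
    ext
    · simp
    · simp
    · rfl
  map_smul' t := fun x : Γ => by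
    change (⟨0, 0, x * t.unop.b⟩ : UpperTriangular Λ M Γ) = ⟨0, 0, x⟩ * t.unop
    ext <;> simp

/-- The projection to the lower right corner, as a map of right modules. -/
def rightBProj : UpperTriangular Λ M Γ →ₗ[(UpperTriangular Λ M Γ)ᵐᵒᵖ]
    Restr (RingHom.op (bHom Λ M Γ)) Γ where
  toFun := b
  map_add' _ _ := rfl
  map_smul' _ _ := rfl

/-- The projection to the upper left corner, as a map of right modules. -/
def rightAProj : UpperTriangular Λ M Γ →ₗ[(UpperTriangular Λ M Γ)ᵐᵒᵖ]
    Restr (RingHom.op (aHom Λ M Γ)) Λ where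
  toFun := a
  map_add' _ _ := rfl
  map_smul' _ _ := rfl

/-- The last column, as a right ideal. -/
def rightCol : Restr (RingHom.op (bHom Λ M Γ)) (M × Γ) →ₗ[(UpperTriangular Λ M Γ)ᵐᵒᵖ]
    UpperTriangular Λ M Γ where
  toFun x := ⟨0, (x : M × Γ).1, (x : M × Γ).2⟩
  map_add' x y := by
    ext
    · simp
    · rfl
    · rfl
  map_smul' t := fun x : M × Γ => by
    change (⟨0, op t.unop.b • x.1, x.2 * t.unop.b⟩ : UpperTriangular Λ M Γ) =
      ⟨0, x.1, x.2⟩ * t.unop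
    ext <;> simp

section

variable {K : ℤ → Type u} [∀ i, AddCommGroup (K i)] [∀ i, Module (UpperTriangular Λ M Γ) (K i)]
  {d : ∀ i, K i →ₗ[UpperTriangular Λ M Γ] K (i + 1)}

/-- Free `Γ`-modules are quotients of free `T`-modules by copies of the first row `Λ ⊕ M`. Free
`Λ`-modules are `T`-projective, and `M` reduces to them by its finite projective dimension. -/
theorem homExact_restr_b (hproj : HasFiniteProjectiveDimension Λ M) (hΓ : StronglyLeftCMFree Γ)
    (hT : IsTotallyAcyclic d) (W : Type u) [AddCommGroup W] [Module Γ W] :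
    HomExact d (Restr (bHom Λ M Γ) W) := by
  have hdd := comp_eq_zero_of_exact hT.exact
  refine hΓ.homExact_restr hT.projective hdd (fun I => ?_) (fun D _ _ => ?_) W
  · refine HomExact.right hT.projective hdd (ι := finsuppRow I) (π := finsuppB I)
      ?_ ?_ ?_ ?_ (hT.homExact _)
    · exact Finsupp.mapRange_injective _ rfl fun p q h =>
        Prod.ext (congrArg UpperTriangular.a h) (congrArg UpperTriangular.m h)
    · refine finsupp_mapRange_exact rfl rfl fun t => ⟨fun h => ⟨(t.a, t.m), ?_⟩, ?_⟩
      · exact UpperTriangular.ext rfl rfl (Eq.symm h)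
      · rintro ⟨p, rfl⟩
        rfl
    · exact Finsupp.mapRange_surjective _ rfl fun y => ⟨⟨0, 0, y⟩, rfl⟩
    · refine homExact_restr_prod _ hT.projective hdd (fun I => ?_) hproj I
      have := projective_restr_a (Λ := Λ) (M := M) (Γ := Γ) I
      exact hT.homExact _
  -- As a right `T`-module, `Γ` is a direct summand of `T`, so `Hom_ℤ(Γ, D)` is a retract of the
  -- injective module `Hom_ℤ(T, D)`.
  · exact (HomExact.of_injective (A := Coind ℤ (UpperTriangular Λ M Γ) D) hT.exact).of_retract
      (Coind.precomp D rightBProj) (Coind.precomp D rightB) fun _ => rfl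

/-- As a right `T`-module, `Λ` is the quotient of `T` by the last column `M ⊕ Γ`, on which `T` acts
through `Γ`. Hence `Hom_ℤ(Λ, D)` is the kernel of a surjection from an injective module onto a
restricted `Γ`-module, and the latter is covered by `homExact_restr_b`. -/
theorem homExact_restr_a (hproj : HasFiniteProjectiveDimension Λ M) (hΛ : StronglyLeftCMFree Λ)
    (hΓ : StronglyLeftCMFree Γ)
    (hT : IsTotallyAcyclic d) (W : Type u) [AddCommGroup W] [Module Λ W] :
    HomExact d (Restr (aHom Λ M Γ) W) := by
  have hdd := comp_eq_zero_of_exact hT.exact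
  refine hΛ.homExact_restr hT.projective hdd (fun I => ?_) (fun D _ _ => ?_) W
  · have := projective_restr_a (Λ := Λ) (M := M) (Γ := Γ) I
    exact hT.homExact _
  · have hsurj : Function.Surjective (rightAProj (Λ := Λ) (M := M) (Γ := Γ)) :=
      fun x => ⟨⟨x, 0, 0⟩, rfl⟩
    refine HomExact.left hT.projective hdd (ι := Coind.precomp D rightAProj)
      (π := Coind.precomp D rightCol) (Coind.precomp_injective hsurj)
      (Coind.precomp_exact ?_ hsurj) (Coind.precomp_surjective ?_)
      (HomExact.of_injective hT.exact)
      ((homExact_restr_b hproj hΓ hT (Coind ℤ (M × Γ) D)).of_equiv (coindRestrEquiv _ _ _))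
    · refine fun t => ⟨fun h => ⟨(t.m, t.b), ?_⟩, ?_⟩
      · exact UpperTriangular.ext (Eq.symm h) rfl rfl
      · rintro ⟨p, rfl⟩
        rfl
    · exact fun p q h =>
        Prod.ext (congrArg UpperTriangular.m h) (congrArg UpperTriangular.b h)

end

end UpperTriangular

/-- A module on which scalars act through a surjective ring homomorphism `σ` is restricted
along `σ`. -/
theorem homExact_of_surjective {R S : Type u} [Ring R] [Ring S] {σ : R →+* S}
    {K : ℤ → Type u} [∀ i, AddCommGroup (K i)] [∀ i, Module R (K i)]
    {d : ∀ i, K i →ₗ[R] K (i + 1)} (hσ : Function.Surjective σ)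
    (h : ∀ (W : Type u) [AddCommGroup W] [Module S W], HomExact d (Restr σ W))
    (W : Type u) [AddCommGroup W] [Module R W]
    (hW : ∀ r r', σ r = σ r' → ∀ w : W, r • w = r' • w) : HomExact d W := by
  -- An arbitrary preimage under `σ` defines the action; by `hW` the choice does not matter.
  let := SMul.mk fun (s : S) (w : W) => Function.surjInv hσ s • w
  have hsmul (r : R) (w : W) : σ r • w = r • w := hW _ _ (Function.surjInv_eq hσ _) w
  let := hσ.moduleLeft σ hsmul
  exact (h W).of_equiv (A := W)
    { toFun w := w
      invFun w := w
      map_add' _ _ := rfl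
      map_smul' r w := (hsmul r w).symm
      left_inv _ := rfl
      right_inv _ := rfl }

namespace UpperTriangular

variable {Λ M Γ : Type u} [Ring Λ] [Ring Γ] [AddCommGroup M] [Module Λ M] [Module Γᵐᵒᵖ M]
  [SMulCommClass Λ Γᵐᵒᵖ M]

theorem stronglyLeftCMFree (hproj : HasFiniteProjectiveDimension Λ M)
    (hΛ : StronglyLeftCMFree Λ) (hΓ : StronglyLeftCMFree Γ) :
    StronglyLeftCMFree (UpperTriangular Λ M Γ) := by
  refine stronglyLeftCMFree_of_homExact fun K _ _ d hT W _ _ => ?_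
  let e : UpperTriangular Λ M Γ := ⟨0, 0, 1⟩
  -- Since `e t = e t e`, the elements killed by the idempotent `e` form a submodule `X`. The action
  -- of `T` on `X` depends only on the upper left entry, and on `W ⧸ X` only on the lower right one.
  have hcomm (t : UpperTriangular Λ M Γ) : e * t = (e * t) * e := by ext <;> simp [e]
  let X : Submodule (UpperTriangular Λ M Γ) W :=
    { carrier := {w | e • w = 0}
      add_mem' := fun {w w'} hw hw' => by
        change e • (w + w') = 0
        rw [smul_add, hw, hw', add_zero]
      zero_mem' := smul_zero e
      smul_mem' := fun t w hw => by
        change e • t • w = 0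
        rw [smul_smul, hcomm, mul_smul, hw, smul_zero] }
  refine HomExact.middle hT.projective (comp_eq_zero_of_exact hT.exact) (ι := X.subtype)
    (π := X.mkQ) Subtype.val_injective (LinearMap.exact_subtype_mkQ X) X.mkQ_surjective ?_ ?_
  · refine homExact_of_surjective (σ := aHom Λ M Γ) (fun x => ⟨⟨x, 0, 0⟩, rfl⟩)
      (fun W _ _ => homExact_restr_a hproj hΛ hΓ hT W) X ?_
    rintro t t' (h : t.a = t'.a) ⟨w, hw⟩
    refine Subtype.ext ?_
    change t • w = t' • w
    rw [← sub_eq_zero, ← sub_smul, show t - t' = (t - t') * e by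
      rw [sub_eq_add_neg]; ext <;> simp [e, h], mul_smul, hw, smul_zero]
  · refine homExact_of_surjective (σ := bHom Λ M Γ) (fun x => ⟨⟨0, 0, x⟩, rfl⟩)
      (fun W _ _ => homExact_restr_b hproj hΓ hT W) (W ⧸ X) ?_
    rintro t t' (h : t.b = t'.b) w
    induction w using Submodule.Quotient.induction_on with | H w =>
    refine (Submodule.Quotient.eq X).2 ?_
    change e • (t • w - t' • w) = 0
    rw [← sub_smul, smul_smul, show e * (t - t') = 0 by
      rw [sub_eq_add_neg]; ext <;> simp [e, h], zero_smul]

end UpperTriangular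

/-! ### From the triangular ring to the diagonal rings -/

namespace UpperTriangular

/-- The last column of the triangular matrix ring. -/
def Col (M Γ : Type u) : Type u := M × Γ

namespace Col

variable {Λ M Γ : Type u}

@[ext] theorem ext {p q : Col M Γ} (h₁ : p.1 = q.1) (h₂ : p.2 = q.2) : p = q := Prod.ext h₁ h₂

variable [AddCommGroup M] [Ring Γ]

instance : AddCommGroup (Col M Γ) := inferInstanceAs (AddCommGroup (M × Γ))

@[simp] theorem add_fst (p q : Col M Γ) : (p + q).1 = p.1 + q.1 := rfl
@[simp] theorem add_snd (p q : Col M Γ) : (p + q).2 = p.2 + q.2 := rfl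
@[simp] theorem zero_fst : (0 : Col M Γ).1 = 0 := rfl
@[simp] theorem zero_snd : (0 : Col M Γ).2 = 0 := rfl

/-- The generator of the last column. -/
def gen : Col M Γ := ((0 : M), (1 : Γ))

@[simp] theorem gen_fst : (gen : Col M Γ).1 = 0 := rfl
@[simp] theorem gen_snd : (gen : Col M Γ).2 = 1 := rfl

variable [Module Γᵐᵒᵖ M]

instance : Module Γᵐᵒᵖ (Col M Γ) := inferInstanceAs (Module Γᵐᵒᵖ (M × Γ))

@[simp] theorem op_smul_fst (x : Γᵐᵒᵖ) (p : Col M Γ) : (x • p).1 = x • p.1 := rfl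
@[simp] theorem op_smul_snd (x : Γᵐᵒᵖ) (p : Col M Γ) : (x • p).2 = x • p.2 := rfl

variable [Ring Λ] [Module Λ M]

instance : SMul (UpperTriangular Λ M Γ) (Col M Γ) :=
  ⟨fun t p => (t.a • p.1 + op p.2 • t.m, t.b * p.2)⟩

@[simp] theorem smul_fst (t : UpperTriangular Λ M Γ) (p : Col M Γ) :
    (t • p).1 = t.a • p.1 + op p.2 • t.m := rfl
@[simp] theorem smul_snd (t : UpperTriangular Λ M Γ) (p : Col M Γ) : (t • p).2 = t.b * p.2 := rfl

end Col

end UpperTriangular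

/-- Restriction of scalars along the identity. -/
def restrIdEquiv (R W : Type u) [Ring R] [AddCommGroup W] [Module R W] :
    W ≃ₗ[R] Restr (RingHom.id R) W where
  toFun w := w
  invFun w := w
  map_add' _ _ := rfl
  map_smul' _ _ := rfl
  left_inv _ := rfl
  right_inv _ := rfl

namespace UpperTriangular

variable {Λ M Γ : Type u} [Ring Λ] [Ring Γ] [AddCommGroup M] [Module Λ M] [Module Γᵐᵒᵖ M]
  [SMulCommClass Λ Γᵐᵒᵖ M]

section Left

variable {W : Type u} [AddCommGroup W] [Module (UpperTriangular Λ M Γ) W]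

theorem coind_a_apply
    (h : Coind (UpperTriangular Λ M Γ) (Restr (aHom Λ M Γ) Λ) W) (x : Λ) :
    h x = (⟨x, 0, 0⟩ : UpperTriangular Λ M Γ) • h (1 : Λ) :=
  (congrArg h (mul_one x).symm).trans (map_smul h (⟨x, 0, 0⟩ : UpperTriangular Λ M Γ)
    (show Restr (aHom Λ M Γ) Λ from (1 : Λ)))

theorem coind_a_smul_apply_one
    (h : Coind (UpperTriangular Λ M Γ) (Restr (aHom Λ M Γ) Λ) W) (x : Λ) :
    (x • h) (1 : Λ) = (⟨x, 0, 0⟩ : UpperTriangular Λ M Γ) • h (1 : Λ) := by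
  rw [← coind_a_apply]
  exact congrArg h (one_mul x)

/-- The entries in the first row of the value at `1`. -/
noncomputable def coindRow (I : Type u) :
    Coind (UpperTriangular Λ M Γ) (Restr (aHom Λ M Γ) Λ) (I →₀ UpperTriangular Λ M Γ) →ₗ[Λ]
      (I →₀ Λ × M) where
  toFun h := Finsupp.mapRange (fun t => (t.a, t.m)) rfl (h (1 : Λ))
  map_add' _ _ := Finsupp.ext fun _ => rfl
  map_smul' x h := by
    rw [coind_a_smul_apply_one]
    ext i <;> simp

/-- The map with a given first row of the value at `1`. -/
noncomputable def coindOfRow (I : Type u) : (I →₀ Λ × M) →ₗ[Λ]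
    Coind (UpperTriangular Λ M Γ) (Restr (aHom Λ M Γ) Λ) (I →₀ UpperTriangular Λ M Γ) where
  toFun w := Coind.of (finsuppRow I ∘ₗ Restr.map _ (LinearMap.toSpanSingleton Λ _ w))
  map_add' w w' := Coind.ext fun x : Λ => by
    change finsuppRow (Γ := Γ) I (x • (w + w')) =
      finsuppRow (Γ := Γ) I (x • w) + finsuppRow (Γ := Γ) I (x • w')
    rw [smul_add]
    exact map_add (finsuppRow I) _ _
  map_smul' y w := Coind.ext fun x : Λ =>
    congrArg (finsuppRow I) (mul_smul x y w).symm

/-- The transfer along the first column `Λ` of `T`. Homomorphisms from this column are determined by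
their value at `1`, so those into free `T`-modules give copies of the first row `Λ ⊕ M`, handled by
the finite projective dimension of `M`. -/
theorem left_stronglyLeftCMFree (hproj : HasFiniteProjectiveDimension Λ M)
    (hT : StronglyLeftCMFree (UpperTriangular Λ M Γ)) : StronglyLeftCMFree Λ := by
  refine stronglyLeftCMFree_of_homExact fun K _ _ d hd W _ _ => ?_
  have hdd := comp_eq_zero_of_exact hd.exact
  have hU : Module.Projective (UpperTriangular Λ M Γ) (Restr (aHom Λ M Γ) Λ) :=
    have := projective_restr_a (Λ := Λ) (M := M) (Γ := Γ) PUnit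
    Module.Projective.of_split (Restr.map _ (Finsupp.lsingle PUnit.unit))
      (Restr.map _ (Finsupp.lapply PUnit.unit)) (LinearMap.ext fun x : Λ => by
        change (Finsupp.single PUnit.unit x) PUnit.unit = x
        simp)
  have hinj (D : Type u) [AddCommGroup D] [Module.Injective ℤ D] :
      HomExact d (Coind ℤ (Restr (aHom Λ M Γ) Λ) D) :=
    have : HomExact d (Coind ℤ Λ D) := HomExact.of_injective hd.exact
    this
  have h := hT.homExact_coind (d := d) (U := Restr (aHom Λ M Γ) Λ) hd.projective hdd hU
    (fun I => ?_) hinj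
    (Restr (aHom Λ M Γ) W)
  -- Evaluation at `1` retracts `Hom_T(Λ, W)` onto `W`.
  · refine h.of_retract
      { toFun w := Coind.of (Restr.map _ (LinearMap.toSpanSingleton Λ W w))
        map_add' w w' := Coind.ext fun x : Λ => smul_add x w w'
        map_smul' y w := Coind.ext fun x : Λ => (mul_smul x y w).symm }
      { toFun h := h (1 : Λ)
        map_add' _ _ := rfl
        map_smul' y h := coind_a_smul_apply_one h y } (fun w => one_smul Λ w)
  · refine HomExact.of_retract (B := I →₀ Λ × M) ?_ (coindRow I) (coindOfRow I) fun h => ?_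
    · exact (homExact_restr_prod (RingHom.id Λ) hd.projective hdd
        (fun I => (hd.homExact (I →₀ Λ)).of_equiv (restrIdEquiv Λ _).symm) hproj I).of_equiv
          (restrIdEquiv Λ _)
    · refine Coind.ext fun x : Λ => ?_
      rw [coind_a_apply h]
      refine Finsupp.ext fun i => ?_
      change (⟨x * (h (1 : Λ) i).a, x • (h (1 : Λ) i).m, 0⟩ : UpperTriangular Λ M Γ) =
        ⟨x, 0, 0⟩ * h (1 : Λ) i
      ext <;> simp

end Left

namespace Col

instance : Module (UpperTriangular Λ M Γ) (Col M Γ) where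
  one_smul p := by ext <;> simp
  mul_smul s t p := by
    ext
    · simp [mul_smul, smul_comm, add_assoc]
    · simp [mul_assoc]
  smul_zero t := by ext <;> simp
  smul_add t p q := by
    ext
    · simp only [smul_fst, add_fst, add_snd, smul_add, MulOpposite.op_add, add_smul]
      abel
    · simp [mul_add]
  add_smul s t p := by
    ext
    · simp only [smul_fst, add_fst, add_a, add_m, smul_add, add_smul]
      abel
    · simp [add_mul]
  zero_smul p := by ext <;> simp

instance : SMulCommClass (UpperTriangular Λ M Γ) Γᵐᵒᵖ (Col M Γ) :=
  ⟨fun t x p => by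
    ext
    · simp [mul_smul, smul_comm]
    · simp [mul_assoc]⟩

/-- The last column is the direct summand `T e` of `T`, where `e` is the lower right idempotent. -/
instance : Module.Projective (UpperTriangular Λ M Γ) (Col M Γ) :=
  Module.Projective.of_split (M := UpperTriangular Λ M Γ)
    { toFun p := ⟨0, p.1, p.2⟩
      map_add' p q := by ext <;> simp
      map_smul' t p := by ext <;> simp }
    { toFun t := (t.m, t.b)
      map_add' _ _ := rfl
      map_smul' _ _ := rfl }
    (LinearMap.ext fun _ => rfl)

variable {W : Type u} [AddCommGroup W] [Module (UpperTriangular Λ M Γ) W]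

theorem coind_apply (h : Coind (UpperTriangular Λ M Γ) (Col M Γ) W) (p : Col M Γ) :
    h p = (⟨0, p.1, p.2⟩ : UpperTriangular Λ M Γ) • h gen := by
  rw [← map_smul]
  refine congrArg h ?_
  ext <;> simp

theorem coind_smul_apply_gen (h : Coind (UpperTriangular Λ M Γ) (Col M Γ) W) (x : Γ) :
    (x • h) gen = (⟨0, 0, x⟩ : UpperTriangular Λ M Γ) • h gen := by
  rw [Coind.smul_apply, coind_apply]
  simp

/-- The lower right entries of the value at the generator. -/
noncomputable def coindB (I : Type u) :
    Coind (UpperTriangular Λ M Γ) (Col M Γ) (I →₀ UpperTriangular Λ M Γ) →ₗ[Γ] (I →₀ Γ) where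
  toFun h := Finsupp.mapRange b rfl (h gen)
  map_add' _ _ := Finsupp.ext fun _ => rfl
  map_smul' x h := by
    rw [coind_smul_apply_gen]
    ext i
    simp

/-- The map with given lower right entries of the value at the generator. -/
noncomputable def coindOfB (I : Type u) : (I →₀ Γ) →ₗ[Γ]
    Coind (UpperTriangular Λ M Γ) (Col M Γ) (I →₀ UpperTriangular Λ M Γ) where
  toFun w := Coind.of
    { toFun p := Finsupp.mapRange (fun x => ⟨0, op x • p.1, p.2 * x⟩) (by ext <;> simp) w
      map_add' p q := by
        ext i <;> simp [add_mul]
      map_smul' t p := by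
        ext i <;> simp [mul_assoc, mul_smul, smul_comm] }
  map_add' w w' := by
    ext p i <;> simp [mul_add, add_smul]
  map_smul' x w := by
    ext p i <;> simp [mul_assoc, mul_smul]

end Col

/-- The transfer along the last column. As this column is `T e`, homomorphisms from it into `T^(I)`
form `e T^(I)`, which is `Γ^(I)`, already a projective test module. -/
theorem right_stronglyLeftCMFree (hflat : HasFiniteFlatDimensionRight Γ M)
    (hT : StronglyLeftCMFree (UpperTriangular Λ M Γ)) : StronglyLeftCMFree Γ := by
  refine stronglyLeftCMFree_of_homExact fun K _ _ d hd W _ _ => ?_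
  have hdd := comp_eq_zero_of_exact hd.exact
  have h := hT.homExact_coind (d := d) (U := Col M Γ) hd.projective hdd inferInstance
    (fun I => ?_) (fun D _ _ => ?_) (Restr (bHom Λ M Γ) W)
  · refine h.of_retract
      { toFun w := Coind.of (W := Restr (bHom Λ M Γ) W)
          { toFun p := (p.2 • w : W)
            map_add' p q := add_smul p.2 q.2 w
            map_smul' t p := mul_smul t.b p.2 w }
        map_add' w w' := Coind.ext fun p => smul_add p.2 w w'
        map_smul' x w := Coind.ext fun p => (mul_smul p.2 x w).symm }
      { toFun h := h Col.gen
        map_add' _ _ := rfl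
        map_smul' x h := Col.coind_smul_apply_gen h x } (fun w => one_smul Γ w)
  · refine (hd.homExact (I →₀ Γ)).of_retract (Col.coindB I) (Col.coindOfB I) fun h => ?_
    refine Coind.ext fun p => ?_
    rw [Col.coind_apply h]
    refine Finsupp.ext fun i => ?_
    change (⟨0, op (h Col.gen i).b • p.1, p.2 * (h Col.gen i).b⟩ : UpperTriangular Λ M Γ) =
      ⟨0, p.1, p.2⟩ * h Col.gen i
    ext <;> simp
  -- As a right `Γ`-module the column is `M ⊕ Γ`. The summand `Γ` dualizes to an injective module,
  -- and `M` is handled by its finite flat dimension.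
  · let ι : M →ₗ[Γᵐᵒᵖ] Col M Γ := LinearMap.inl Γᵐᵒᵖ M Γ
    let π : Col M Γ →ₗ[Γᵐᵒᵖ] Γ := LinearMap.snd Γᵐᵒᵖ M Γ
    have hπ : Function.Surjective π := LinearMap.snd_surjective
    exact HomExact.middle hd.projective hdd (Coind.precomp_injective hπ)
      (Coind.precomp_exact (ι := ι) Function.Exact.inl_snd hπ)
      (Coind.precomp_surjective LinearMap.inl_injective)
      (HomExact.of_injective hd.exact)
      (homExact_coind_of_hasFiniteFlatDimensionRight hflat hd.projective hd.exact D)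

end UpperTriangular

end TriCM

theorem corollary3p10 {Λ Γ M : Type u} [Ring Λ] [Ring Γ] [AddCommGroup M]
    [Module Λ M] [Module Γᵐᵒᵖ M] [SMulCommClass Λ Γᵐᵒᵖ M]
    (hflat : TriCM.HasFiniteFlatDimensionRight Γ M)
    (hproj : TriCM.HasFiniteProjectiveDimension Λ M) :
    TriCM.StronglyLeftCMFree (TriCM.UpperTriangular Λ M Γ) ↔
      TriCM.StronglyLeftCMFree Λ ∧ TriCM.StronglyLeftCMFree Γ :=
  ⟨fun h => ⟨TriCM.UpperTriangular.left_stronglyLeftCMFree hproj h,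
    TriCM.UpperTriangular.right_stronglyLeftCMFree hflat h⟩,
    fun h => TriCM.UpperTriangular.stronglyLeftCMFree hproj h.1 h.2⟩
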